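/- Let $m\ge 1$ and $n\ge 0$, and let $M$ and $N$ be smooth manifolds (Hausdorff, second countable, without boundary, not necessarily connected or compact) of dimensions $m$ and $n$. Write $\varepsilon^1_B$ for the trivial real line bundle over $B$. Suppose that 1. the vector bundle $T(M)\oplus\varepsilon^1_M$ is trivial; 2. the vector bundle $T(N)\oplus\varepsilon^1_N$ is trivial; 3. there is a nowhere-vanishing smooth vector field on $N$. Then $M\times N$ is parallelizable, that is, its tangent bundle $T(M\times N)$ is trivial. (Here a smooth vector bundle of rank $k$ over $B$ is called trivial if it is isomorphic, as a smooth vector bundle over $B$, to $B\times\mathbb{R}^k$.) -/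

import Mathlib

open scoped Manifold ContDiff Bundle

/-- Two smooth real vector bundles `V`, `V'` over the same base `B` (with model fibres `F`, `F'`) are
isomorphic as smooth vector bundles over `B`: there are linear isomorphisms of the fibres `V x ≃ V' x`
such that the induced bijection of total spaces is smooth in both directions. -/
def SmoothBundleIsomorphic
    {EB : Type*} [NormedAddCommGroup EB] [NormedSpace ℝ EB]
    {HB : Type*} [TopologicalSpace HB] (IB : ModelWithCorners ℝ EB HB)
    {B : Type*} [TopologicalSpace B] [ChartedSpace HB B]
    (F : Type*) [NormedAddCommGroup F] [NormedSpace ℝ F]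
    (V : B → Type*) [TopologicalSpace (Bundle.TotalSpace F V)]
    [∀ x, AddCommGroup (V x)] [∀ x, Module ℝ (V x)] [∀ x, TopologicalSpace (V x)] [FiberBundle F V]
    (F' : Type*) [NormedAddCommGroup F'] [NormedSpace ℝ F']
    (V' : B → Type*) [TopologicalSpace (Bundle.TotalSpace F' V')]
    [∀ x, AddCommGroup (V' x)] [∀ x, Module ℝ (V' x)] [∀ x, TopologicalSpace (V' x)]
    [FiberBundle F' V'] : Prop :=
  ∃ e : ∀ x : B, V x ≃ₗ[ℝ] V' x,
    ContMDiff (IB.prod 𝓘(ℝ, F)) (IB.prod 𝓘(ℝ, F')) ∞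
      (fun p : Bundle.TotalSpace F V ↦ Bundle.TotalSpace.mk' F' p.1 (e p.1 p.2)) ∧
    ContMDiff (IB.prod 𝓘(ℝ, F')) (IB.prod 𝓘(ℝ, F)) ∞
      (fun p : Bundle.TotalSpace F' V' ↦ Bundle.TotalSpace.mk' F p.1 ((e p.1).symm p.2))

/-- A smooth real vector bundle with model fibre `F` is trivial if it is isomorphic, as a smooth vector
bundle, to the product bundle `B × F`. -/
def IsTrivialBundle
    {EB : Type*} [NormedAddCommGroup EB] [NormedSpace ℝ EB]
    {HB : Type*} [TopologicalSpace HB] (IB : ModelWithCorners ℝ EB HB)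
    {B : Type*} [TopologicalSpace B] [ChartedSpace HB B]
    (F : Type*) [NormedAddCommGroup F] [NormedSpace ℝ F]
    (V : B → Type*) [TopologicalSpace (Bundle.TotalSpace F V)]
    [∀ x, AddCommGroup (V x)] [∀ x, Module ℝ (V x)] [∀ x, TopologicalSpace (V x)]
    [FiberBundle F V] : Prop :=
  SmoothBundleIsomorphic IB F V F (Bundle.Trivial B F)

/-- `T(M) ⊕ ε¹` is trivial: the Whitney sum of the tangent bundle and the product line bundle. -/
def IsStablyTrivialTangent
    {E : Type*} [NormedAddCommGroup E] [NormedSpace ℝ E]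
    {H : Type*} [TopologicalSpace H] (I : ModelWithCorners ℝ E H)
    (M : Type*) [TopologicalSpace M] [ChartedSpace H M] [IsManifold I ∞ M] : Prop :=
  haveI : IsManifold I 1 M := IsManifold.of_le (n := ∞) (by simp)
  IsTrivialBundle I (E × ℝ) ((TangentSpace I : M → Type _) ×ᵇ Bundle.Trivial M ℝ)

/-- A smooth manifold is parallelizable if its tangent bundle is trivial. -/
def IsParallelizable
    {E : Type*} [NormedAddCommGroup E] [NormedSpace ℝ E]
    {H : Type*} [TopologicalSpace H] (I : ModelWithCorners ℝ E H)
    (M : Type*) [TopologicalSpace M] [ChartedSpace H M] [IsManifold I ∞ M] : Prop :=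
  haveI : IsManifold I 1 M := IsManifold.of_le (n := ∞) (by simp)
  IsTrivialBundle I E (TangentSpace I : M → Type _)

/-- There is a smooth vector field on `M` without zeros. -/
def HasNonvanishingVectorField
    {E : Type*} [NormedAddCommGroup E] [NormedSpace ℝ E]
    {H : Type*} [TopologicalSpace H] (I : ModelWithCorners ℝ E H)
    (M : Type*) [TopologicalSpace M] [ChartedSpace H M] [IsManifold I ∞ M] : Prop :=
  haveI : IsManifold I 1 M := IsManifold.of_le (n := ∞) (by simp)
  ∃ X : ∀ x : M, TangentSpace I x,
    ContMDiff I I.tangent ∞ (fun x ↦ (⟨x, X x⟩ : TangentBundle I M)) ∧ ∀ x, X x ≠ 0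

/-!
The tangent bundle of `M × N` is the sum of the pullbacks of `TM` and `TN`, so its fibre at `(x, y)`
is `T_x M × T_y N`. The vector field `X` splits off a trivial line: stable triviality embeds `TN` in
a product bundle, the Euclidean metric there restricts to `TN`, and pairing with `X` produces a smooth
`1`-form `α` with `α X = 1` (`exists_smooth_dual_of_stablyTrivial`; no partition of unity is needed).
Lending the line `ℝ X` to `TM` and using `TM ⊕ ε¹ ≅ ε^(m+1)` turns `TM ⊕ TN` into `ε^m ⊕ TN`.
Since `m ≥ 1`, a line can be lent from `ε^m` to `TN` in the same way, and `TN ⊕ ε¹ ≅ ε^(n+1)` turns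
`ε^m ⊕ TN` into `ε^m ⊕ ε^n`.

Both steps are the linear isomorphism `transferLine`, given with its inverse by a formula which is
polynomial in the trivialization, `α` and `X`. Smoothness of the resulting bundle maps is then checked
on smooth families of vectors, over an arbitrary parameter manifold `P` and along a base map
`b : P → B`: such families are closed under sums and under multiplication by smooth functions, and a
family in a sum of bundles is smooth exactly when its components are.
-/

open Bundle

/-! ### Smooth families of vectors in a bundle -/

section VectorBundle

variable {EB : Type*} [NormedAddCommGroup EB] [NormedSpace ℝ EB]
  {HB : Type*} [TopologicalSpace HB] {IB : ModelWithCorners ℝ EB HB}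
  {B : Type*} [TopologicalSpace B] [ChartedSpace HB B]
  {F : Type*} [NormedAddCommGroup F] [NormedSpace ℝ F]
  {F' : Type*} [NormedAddCommGroup F'] [NormedSpace ℝ F']
  {V : B → Type*} [TopologicalSpace (TotalSpace F V)]
  [∀ x, AddCommGroup (V x)] [∀ x, TopologicalSpace (V x)] [FiberBundle F V]
  {EP : Type*} [NormedAddCommGroup EP] [NormedSpace ℝ EP]
  {HP : Type*} [TopologicalSpace HP] {IP : ModelWithCorners ℝ EP HP}
  {P : Type*} [TopologicalSpace P] [ChartedSpace HP P]
  {b : P → B}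

theorem contMDiff_trivial_iff {f : P → F} :
    ContMDiff IP (IB.prod 𝓘(ℝ, F)) ∞ (fun p ↦ TotalSpace.mk' F (E := Trivial B F) (b p) (f p)) ↔
      ContMDiff IP IB ∞ b ∧ ContMDiff IP 𝓘(ℝ, F) ∞ f := by
  refine ⟨fun h ↦ ⟨fun p ↦ (contMDiffAt_totalSpace.1 (h p)).1,
    fun p ↦ (contMDiffAt_totalSpace.1 (h p)).2⟩, fun h p ↦ ?_⟩
  exact contMDiffAt_totalSpace.2 ⟨h.1 p, h.2 p⟩

theorem contMDiff_prod_trivial_iff {v : ∀ p, V (b p)} {f : P → F'} :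
    ContMDiff IP (IB.prod 𝓘(ℝ, F × F')) ∞
        (fun p ↦ TotalSpace.mk' (F × F') (E := V ×ᵇ Trivial B F') (b p) (v p, f p)) ↔
      ContMDiff IP (IB.prod 𝓘(ℝ, F)) ∞ (fun p ↦ TotalSpace.mk' F (b p) (v p)) ∧
        ContMDiff IP 𝓘(ℝ, F') ∞ f := by
  constructor
  · intro h
    refine ⟨fun p ↦ ?_, fun p ↦ ?_⟩
    · obtain ⟨h₁, h₂⟩ := contMDiffAt_totalSpace.1 (h p)
      exact contMDiffAt_totalSpace.2 ⟨h₁, (contMDiffAt_prod_module_iff _).1 h₂ |>.1⟩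
    · exact (contMDiffAt_prod_module_iff _).1 (contMDiffAt_totalSpace.1 (h p)).2 |>.2
  · rintro ⟨h, hf⟩ p
    obtain ⟨h₁, h₂⟩ := contMDiffAt_totalSpace.1 (h p)
    exact contMDiffAt_totalSpace.2 ⟨h₁, h₂.prodMk_space (hf p)⟩

variable [∀ x, Module ℝ (V x)]

theorem ContMDiff.add_bundle [VectorBundle ℝ F V] {v w : ∀ p, V (b p)}
    (hv : ContMDiff IP (IB.prod 𝓘(ℝ, F)) ∞ (fun p ↦ TotalSpace.mk' F (b p) (v p)))
    (hw : ContMDiff IP (IB.prod 𝓘(ℝ, F)) ∞ (fun p ↦ TotalSpace.mk' F (b p) (w p))) :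
    ContMDiff IP (IB.prod 𝓘(ℝ, F)) ∞ (fun p ↦ TotalSpace.mk' F (b p) (v p + w p)) := by
  intro p
  obtain ⟨hb, h₁⟩ := contMDiffAt_totalSpace.1 (hv p)
  obtain ⟨-, h₂⟩ := contMDiffAt_totalSpace.1 (hw p)
  refine contMDiffAt_totalSpace.2 ⟨hb, (h₁.add h₂).congr_of_eventuallyEq ?_⟩
  have := hb.continuousAt.preimage_mem_nhds
    ((trivializationAt F V (b p)).open_baseSet.mem_nhds (mem_baseSet_trivializationAt F V (b p)))
  filter_upwards [this] with q hq
  exact ((trivializationAt F V (b p)).linear ℝ hq).1 _ _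

theorem ContMDiff.smul_bundle [VectorBundle ℝ F V] {c : P → ℝ} {v : ∀ p, V (b p)}
    (hc : ContMDiff IP 𝓘(ℝ, ℝ) ∞ c)
    (hv : ContMDiff IP (IB.prod 𝓘(ℝ, F)) ∞ (fun p ↦ TotalSpace.mk' F (b p) (v p))) :
    ContMDiff IP (IB.prod 𝓘(ℝ, F)) ∞ (fun p ↦ TotalSpace.mk' F (b p) (c p • v p)) := by
  intro p
  obtain ⟨hb, h₁⟩ := contMDiffAt_totalSpace.1 (hv p)
  refine contMDiffAt_totalSpace.2 ⟨hb, ((hc p).smul h₁).congr_of_eventuallyEq ?_⟩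
  have := hb.continuousAt.preimage_mem_nhds
    ((trivializationAt F V (b p)).open_baseSet.mem_nhds (mem_baseSet_trivializationAt F V (b p)))
  filter_upwards [this] with q hq
  exact ((trivializationAt F V (b p)).linear ℝ hq).2 _ _

/-- Triviality of `V` expressed on the manifold `B × F`: the fibrewise isomorphisms `V x ≃ F` and their
inverses are jointly smooth. Avoiding the total space of `Trivial B F` matters when `F` is a product:
`Trivial B (F₁ × F₂)` is then also a fibrewise product of two bundles, and instance search finds a
topology on its total space which is not definitionally the expected one. -/
theorem isTrivialBundle_iff :
    IsTrivialBundle IB F V ↔ ∃ φ : ∀ x, V x ≃ₗ[ℝ] F,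
      ContMDiff (IB.prod 𝓘(ℝ, F)) 𝓘(ℝ, F) ∞ (fun q : TotalSpace F V ↦ φ q.1 q.2) ∧
      ContMDiff (IB.prod 𝓘(ℝ, F)) (IB.prod 𝓘(ℝ, F)) ∞
        (fun q : B × F ↦ TotalSpace.mk' F q.1 ((φ q.1).symm q.2)) := by
  constructor
  · rintro ⟨φ, h₁, h₂⟩
    exact ⟨φ, (contMDiff_trivial_iff.1 h₁).2,
      h₂.comp (contMDiff_trivial_iff.2 ⟨contMDiff_fst, contMDiff_snd⟩)⟩
  · rintro ⟨φ, h₁, h₂⟩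
    have hid := contMDiff_trivial_iff.1
      (contMDiff_id (I := IB.prod 𝓘(ℝ, F)) (n := ∞) (M := TotalSpace F (Trivial B F)))
    exact ⟨φ, contMDiff_trivial_iff.2 ⟨contMDiff_proj V, h₁⟩, h₂.comp (hid.1.prodMk hid.2)⟩

end VectorBundle

/-! ### Moving a line from one summand to another -/

section Transfer

variable {V W F : Type*} [AddCommGroup V] [Module ℝ V] [AddCommGroup W] [Module ℝ W]
  [AddCommGroup F] [Module ℝ F]

/-- An isomorphism `φ : V × ℝ ≃ F × ℝ` induces `V × W ≃ F × W` as soon as `W` contains a line split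
off by a functional: with `α X = 1`, `W` is `ker α ⊕ ℝ X`, and `φ` is applied to `V ⊕ ℝ X` while
`ker α` is left alone. Writing `φ (v, α w) = (a, s)`, the pair `(v, w)` goes to
`(a, w + (s - α w) • X)`, and the inverse is the same construction for `φ.symm`. -/
def transferLine (φ : (V × ℝ) ≃ₗ[ℝ] F × ℝ) (α : W →ₗ[ℝ] ℝ) (X : W) (h : α X = 1) :
    (V × W) ≃ₗ[ℝ] F × W where
  toFun p := ((φ (p.1, α p.2)).1, p.2 + ((φ (p.1, α p.2)).2 - α p.2) • X)
  invFun p := ((φ.symm (p.1, α p.2)).1, p.2 + ((φ.symm (p.1, α p.2)).2 - α p.2) • X)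
  map_add' p q := by
    have : φ (p.1 + q.1, α p.2 + α q.2) = φ (p.1, α p.2) + φ (q.1, α q.2) := by
      rw [← LinearEquiv.map_add, Prod.mk_add_mk]
    ext
    · simp [this]
    · simp only [Prod.fst_add, Prod.snd_add, map_add, this]
      module
  map_smul' c p := by
    have : φ (c • p.1, c * α p.2) = c • φ (p.1, α p.2) := by
      rw [← LinearEquiv.map_smul, Prod.smul_mk, smul_eq_mul]
    ext
    · simp [this]
    · simp only [Prod.smul_fst, Prod.smul_snd, map_smul, smul_eq_mul, this, RingHom.id_apply]
      module
  left_inv p := by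
    ext
    · simp [h]
    · simp only [map_add, map_smul, h, smul_eq_mul, mul_one, add_sub_cancel, Prod.mk.eta,
        LinearEquiv.symm_apply_apply]
      module
  right_inv p := by
    ext
    · simp [h]
    · simp only [map_add, map_smul, h, smul_eq_mul, mul_one, add_sub_cancel, Prod.mk.eta,
        LinearEquiv.apply_symm_apply]
      module

end Transfer

/-! ### Tangent bundles -/

section Manifold

variable {E : Type*} [NormedAddCommGroup E] [NormedSpace ℝ E]
  {H : Type*} [TopologicalSpace H] {I : ModelWithCorners ℝ E H}
  {M : Type*} [TopologicalSpace M] [ChartedSpace H M] [IsManifold I ∞ M]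
  {E' : Type*} [NormedAddCommGroup E'] [NormedSpace ℝ E']
  {H' : Type*} [TopologicalSpace H'] {I' : ModelWithCorners ℝ E' H'}
  {N : Type*} [TopologicalSpace N] [ChartedSpace H' N] [IsManifold I' ∞ N]
  {EP : Type*} [NormedAddCommGroup EP] [NormedSpace ℝ EP]
  {HP : Type*} [TopologicalSpace HP] {IP : ModelWithCorners ℝ EP HP}
  {P : Type*} [TopologicalSpace P] [ChartedSpace HP P]

theorem contMDiff_tangentBundle_prod_iff {b : P → M} {c : P → N}
    {u : ∀ p, TangentSpace I (b p)} {v : ∀ p, TangentSpace I' (c p)} :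
    ContMDiff IP (I.prod I').tangent ∞
        (fun p ↦ (⟨(b p, c p), (u p, v p)⟩ : TangentBundle (I.prod I') (M × N))) ↔
      ContMDiff IP I.tangent ∞ (fun p ↦ (⟨b p, u p⟩ : TangentBundle I M)) ∧
        ContMDiff IP I'.tangent ∞ (fun p ↦ (⟨c p, v p⟩ : TangentBundle I' N)) := by
  have : IsManifold I 1 M := IsManifold.of_le (n := ∞) (by simp)
  have : IsManifold I' 1 N := IsManifold.of_le (n := ∞) (by simp)
  constructor
  · intro h
    have := contMDiff_equivTangentBundleProd.comp h
    exact ⟨this.fst, this.snd⟩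
  · rintro ⟨h₁, h₂⟩
    exact contMDiff_equivTangentBundleProd_symm.comp (h₁.prodMk h₂)

/-- On a manifold with stably trivial tangent bundle, a nowhere vanishing vector field `X` has a smooth
dual `1`-form: with `β : TN → E' ⊕ ℝ` the restriction to `TN` of the trivialization of `TN ⊕ ε¹`, take
`α v = ⟪β X, β v⟫ / ‖β X‖²`. -/
theorem exists_smooth_dual_of_stablyTrivial {E' : Type*} [NormedAddCommGroup E']
    [InnerProductSpace ℝ E'] {I' : ModelWithCorners ℝ E' H'} [IsManifold I' ∞ N]
    (hN : IsStablyTrivialTangent I' N) {X : ∀ y : N, TangentSpace I' y}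
    (hX : ContMDiff I' I'.tangent ∞ (fun y ↦ (⟨y, X y⟩ : TangentBundle I' N)))
    (hX₀ : ∀ y, X y ≠ 0) :
    ∃ α : ∀ y : N, TangentSpace I' y →ₗ[ℝ] ℝ, (∀ y, α y (X y) = 1) ∧
      ContMDiff I'.tangent 𝓘(ℝ, ℝ) ∞ (fun p : TangentBundle I' N ↦ α p.1 p.2) := by
  have : IsManifold I' 1 N := IsManifold.of_le (n := ∞) (by simp)
  obtain ⟨ψ, hψ, -⟩ := isTrivialBundle_iff.1 hN
  -- The product `E' × ℝ` is normed by the maximum; `WithLp 2` supplies an inner product.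
  let β : ∀ y : N, TangentSpace I' y →ₗ[ℝ] WithLp 2 (E' × ℝ) := fun y ↦
    (WithLp.linearEquiv 2 ℝ (E' × ℝ)).symm.toLinearMap ∘ₗ (ψ y).toLinearMap ∘ₗ
      LinearMap.inl ℝ (TangentSpace I' y) ℝ
  have hβ₀ : ∀ y, β y (X y) ≠ 0 := by
    intro y h
    have h' : ψ y (X y, 0) = 0 := (WithLp.linearEquiv 2 ℝ (E' × ℝ)).symm.map_eq_zero_iff.1 h
    exact hX₀ y (congrArg Prod.fst ((ψ y).map_eq_zero_iff.1 h'))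
  have hβ : ContMDiff I'.tangent 𝓘(ℝ, WithLp 2 (E' × ℝ)) ∞
      (fun p : TangentBundle I' N ↦ β p.1 p.2) :=
    (WithLp.prodContinuousLinearEquiv 2 ℝ E' ℝ).symm.contDiff.contMDiff.comp
      (hψ.comp (contMDiff_prod_trivial_iff.2 ⟨contMDiff_id, contMDiff_const (c := (0 : ℝ))⟩))
  have hβX : ContMDiff I' 𝓘(ℝ, WithLp 2 (E' × ℝ)) ∞ (fun y ↦ β y (X y)) := hβ.comp hX
  have hβX' : ContMDiff I'.tangent 𝓘(ℝ, WithLp 2 (E' × ℝ)) ∞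
      (fun p : TangentBundle I' N ↦ β p.1 (X p.1)) := hβX.comp (contMDiff_proj _)
  refine ⟨fun y ↦ (‖β y (X y)‖ ^ 2)⁻¹ • (innerₛₗ ℝ (β y (X y))) ∘ₗ β y, fun y ↦ ?_, ?_⟩
  · have := norm_ne_zero_iff.2 (hβ₀ y)
    change (‖β y (X y)‖ ^ 2)⁻¹ * inner ℝ (β y (X y)) (β y (X y)) = 1
    rw [real_inner_self_eq_norm_sq, inv_mul_cancel₀ (pow_ne_zero 2 this)]
  · intro p
    have hn : ContMDiffAt I'.tangent 𝓘(ℝ, ℝ) ∞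
        (fun p : TangentBundle I' N ↦ (‖β p.1 (X p.1)‖ ^ 2)⁻¹) p :=
      ((contDiff_norm_sq ℝ).contMDiff.comp hβX' p).inv₀
        (pow_ne_zero 2 (norm_ne_zero_iff.2 (hβ₀ p.1)))
    have hi : ContMDiffAt I'.tangent 𝓘(ℝ, ℝ) ∞
        (fun p : TangentBundle I' N ↦ inner ℝ (β p.1 (X p.1)) (β p.1 p.2)) p :=
      contDiff_inner.contMDiff.comp (hβX'.prodMk_space hβ) p
    exact hn.mul hi

/-- A product of stably parallelizable manifolds is parallelizable if the first factor has positive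
dimension and the second one carries a nowhere vanishing vector field. -/
theorem isParallelizable_prod [Nontrivial E] {E' : Type*} [NormedAddCommGroup E']
    [InnerProductSpace ℝ E'] {I' : ModelWithCorners ℝ E' H'} [IsManifold I' ∞ N]
    (hM : IsStablyTrivialTangent I M) (hN : IsStablyTrivialTangent I' N)
    (hX : HasNonvanishingVectorField I' N) : IsParallelizable (I.prod I') (M × N) := by
  have : IsManifold I 1 M := IsManifold.of_le (n := ∞) (by simp)
  have : IsManifold I' 1 N := IsManifold.of_le (n := ∞) (by simp)
  obtain ⟨X, hX, hX₀⟩ := hX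
  obtain ⟨α, hα₁, hα⟩ := exists_smooth_dual_of_stablyTrivial hN hX hX₀
  obtain ⟨φ, hφ, hφ'⟩ := isTrivialBundle_iff.1 hM
  obtain ⟨ψ, hψ, hψ'⟩ := isTrivialBundle_iff.1 hN
  obtain ⟨e, he⟩ := exists_ne (0 : E)
  obtain ⟨ε, hε⟩ := SeparatingDual.exists_eq_one (R := ℝ) he
  -- `T_x M × T_y N ≃ E × T_y N` lends the line `ℝ X` to `TM`, and `T_y N × E ≃ E' × E` lends the
  -- line `ℝ e`, split off by `ε`, to `TN`.
  let T : ∀ z : M × N, TangentSpace (I.prod I') z ≃ₗ[ℝ] E × E' := fun z ↦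
    (transferLine (φ z.1) (α z.2) (X z.2) (hα₁ z.2)).trans <|
      (LinearEquiv.prodComm ℝ E (TangentSpace I' z.2)).trans <|
        (transferLine (ψ z.2) ε.toLinearMap e hε).trans <| LinearEquiv.prodComm ℝ E' E
  refine isTrivialBundle_iff.2 ⟨T, ?_, ?_⟩
  · obtain ⟨hu, hv⟩ := contMDiff_tangentBundle_prod_iff.1
      (contMDiff_id (I := (I.prod I').tangent) (M := TangentBundle (I.prod I') (M × N)))
    have hαv := hα.comp hv
    have hXy := hX.comp ((contMDiff_proj _).comp hv)
    have h₁ := hφ.comp (contMDiff_prod_trivial_iff.2 ⟨hu, hαv⟩)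
    obtain ⟨ha, hs⟩ := (contMDiff_prod_module_iff _).1 h₁
    have hw := hv.add_bundle ((hs.sub hαv).smul_bundle hXy)
    have hεa := ε.contDiff.contMDiff.comp ha
    have h₂ := hψ.comp (contMDiff_prod_trivial_iff.2 ⟨hw, hεa⟩)
    obtain ⟨hd, hr⟩ := (contMDiff_prod_module_iff _).1 h₂
    exact (ha.add ((hr.sub hεa).smul (contMDiff_const (c := e)))).prodMk_space hd
  · have hx : ContMDiff ((I.prod I').prod 𝓘(ℝ, E × E')) I ∞
        (fun q : (M × N) × E × E' ↦ q.1.1) := contMDiff_fst.fst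
    have hy : ContMDiff ((I.prod I').prod 𝓘(ℝ, E × E')) I' ∞
        (fun q : (M × N) × E × E' ↦ q.1.2) := contMDiff_fst.snd
    obtain ⟨ha, hd⟩ := (contMDiff_prod_module_iff _).1
      (contMDiff_snd (I := I.prod I') (J := 𝓘(ℝ, E × E')) (n := ∞) (M := M × N) (N := E × E'))
    have hεa := ε.contDiff.contMDiff.comp ha
    obtain ⟨hw, hr⟩ := contMDiff_prod_trivial_iff.1 (hψ'.comp (hy.prodMk (hd.prodMk_space hεa)))
    have ha' := ha.add ((hr.sub hεa).smul (contMDiff_const (c := e)))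
    have hαw := hα.comp hw
    obtain ⟨hu, ht⟩ := contMDiff_prod_trivial_iff.1
      (hφ'.comp (hx.prodMk (ha'.prodMk_space hαw)))
    exact contMDiff_tangentBundle_prod_iff.2
      ⟨hu, hw.add_bundle ((ht.sub hαw).smul_bundle (hX.comp hy))⟩

end Manifold

theorem mainTheorem2 {m n : ℕ} (hm : 1 ≤ m)
    {M : Type*} [TopologicalSpace M] [T2Space M] [SecondCountableTopology M]
    [ChartedSpace (EuclideanSpace ℝ (Fin m)) M] [IsManifold (𝓡 m) ∞ M]
    {N : Type*} [TopologicalSpace N] [T2Space N] [SecondCountableTopology N]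
    [ChartedSpace (EuclideanSpace ℝ (Fin n)) N] [IsManifold (𝓡 n) ∞ N]
    (hM : IsStablyTrivialTangent (𝓡 m) M) (hN : IsStablyTrivialTangent (𝓡 n) N)
    (hX : HasNonvanishingVectorField (𝓡 n) N) :
    IsParallelizable ((𝓡 m).prod (𝓡 n)) (M × N) := by
  -- provides the nontriviality of `EuclideanSpace ℝ (Fin m)`
  have : NeZero m := ⟨by omega⟩
  exact isParallelizable_prod hM hN hX
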